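/- Conventions. For a finite field $F$, a linear code of length $n$ over $F$ is a subspace of $F^n$, and $d(C)$ denotes its minimum Hamming distance. A linear code is negacyclic if $(c_0,c_1,\dots,c_{n-1})\in C$ implies $(-c_{n-1},c_0,\dots,c_{n-2})\in C$. Identifying $(c_0,\dots,c_{n-1})$ with $c_0+c_1x+\cdots+c_{n-1}x^{n-1}$, a negacyclic code is an ideal of $F[x]/(x^n+1)$. Its generator polynomial $g$ is the monic polynomial of smallest degree that generates this ideal, and its check polynomial is $(x^n+1)/g(x)$. The code is irreducible if its check polynomial is irreducible over $F$. Theorem. Let $\rho>3$ be a prime with $\rho\equiv\pm5\pmod{12}$ and $\mathrm{ord}_\rho(3)=\rho-1$. Let $\beta\in\mathrm{GF}(3^{\rho-1})$ be a primitive $4\rho$-th root of unity, and let $\mathbb{M}_\beta(x)$ be its minimal polynomial over $\mathrm{GF}(3)$. Let $\mathcal{C}(\rho)$ be the ternary negacyclic code of length $2\rho$ with check polynomial $\mathbb{M}_\beta(x)$, which is irreducible. With $\theta=\beta^{-1}$, let $$\overline{\mathcal{C}}(\rho)=\Big\{\big(\mathrm{Tr}_{3^{\rho-1}/3^2}(a\,\theta^{2i})\big)_{i=0}^{\rho-1}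 : a\in\mathrm{GF}(3^{\rho-1})\Big\},$$ which is a negacyclic code of length $\rho$ over $\mathrm{GF}(9)$. Then $\dim\mathcal{C}(\rho)=\rho-1$ and $$d(\mathcal{C}(\rho))\ \ge\ d(\overline{\mathcal{C}}(\rho))\ \ge\ \sqrt{\rho}+1 .$$ -/

import Mathlib

open Polynomial

/-! A linear code of length `n` over a field `F` is a subspace `C : Submodule F (Fin n → F)`. -/

namespace NegacyclicCodes

/-- The minimum (Hamming) distance of a linear code. -/
noncomputable def minDist {F : Type*} [Field F] [DecidableEq F] {n : ℕ}
    (C : Submodule F (Fin n → F)) : ℕ :=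
  sInf {d : ℕ | ∃ x ∈ C, ∃ y ∈ C, x ≠ y ∧ hammingDist x y = d}

/-- The constacyclic shift `(c₀, c₁, …, cₙ₋₁) ↦ (l cₙ₋₁, c₀, …, cₙ₋₂)`. -/
def constaShift {F : Type*} [Field F] {n : ℕ} (l : F) (c : Fin n → F) : Fin n → F :=
  fun i => if (i : ℕ) = 0 then l * c ⟨n - 1, by have := i.isLt; omega⟩
    else c ⟨(i : ℕ) - 1, by have := i.isLt; omega⟩

/-- `l`-constacyclic linear codes. -/
def IsConstacyclic {F : Type*} [Field F] {n : ℕ} (l : F)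
    (C : Submodule F (Fin n → F)) : Prop :=
  ∀ c ∈ C, constaShift l c ∈ C

/-- Negacyclic codes are the `(-1)`-constacyclic ones. -/
def IsNegacyclic {F : Type*} [Field F] {n : ℕ} (C : Submodule F (Fin n → F)) : Prop :=
  IsConstacyclic (-1) C

/-- The word `(c₀, …, cₙ₋₁)` as the polynomial `c₀ + c₁ x + ⋯ + cₙ₋₁ xⁿ⁻¹`. -/
noncomputable def wordPoly (F : Type*) [Field F] (n : ℕ) : (Fin n → F) →ₗ[F] F[X] :=
  ∑ i : Fin n, (monomial (i : ℕ)) ∘ₗ (LinearMap.proj i)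

/-- The map `Φ : Fⁿ → F[x]/(xⁿ - l)`. -/
noncomputable def toQuot {F : Type*} [Field F] (n : ℕ) (l : F) :
    (Fin n → F) →ₗ[F] AdjoinRoot (X ^ n - C l : F[X]) :=
  (AdjoinRoot.mkₐ (X ^ n - C l : F[X])).toLinearMap ∘ₗ wordPoly F n

/-- The ideal `(g)` of `F[x]/(xⁿ - l)`, as an `F`-subspace. -/
noncomputable def idealOf {F : Type*} [Field F] (n : ℕ) (l : F) (g : F[X]) :
    Submodule F (AdjoinRoot (X ^ n - C l : F[X])) :=
  (Ideal.span {AdjoinRoot.mk (X ^ n - C l : F[X]) g}).restrictScalars F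

/-- `g` is the generator polynomial of the `l`-constacyclic code `𝒞`: it is monic, generates the
ideal `Φ(𝒞)`, and has the smallest degree among the monic polynomials that do. -/
def IsGeneratorPolynomial {F : Type*} [Field F] {n : ℕ} (l : F)
    (𝒞 : Submodule F (Fin n → F)) (g : F[X]) : Prop :=
  (g.Monic ∧ 𝒞.map (toQuot n l) = idealOf n l g) ∧
    ∀ g' : F[X], g'.Monic → 𝒞.map (toQuot n l) = idealOf n l g' → g.natDegree ≤ g'.natDegree

/-- `h` is the check polynomial `(xⁿ - l) / g` of the `l`-constacyclic code `𝒞` with generator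
polynomial `g`. -/
def IsCheckPolynomial {F : Type*} [Field F] {n : ℕ} (l : F)
    (𝒞 : Submodule F (Fin n → F)) (h : F[X]) : Prop :=
  ∃ g : F[X], IsGeneratorPolynomial l 𝒞 g ∧ g * h = X ^ n - C l

/-- The negacyclic code of length `n` over `F` with check polynomial `h` (for a monic divisor
`h` of `xⁿ + 1`): the words `c` with `Φ(c)` in the ideal generated by `(xⁿ + 1) / h`. -/
noncomputable def negacyclicCode {F : Type*} [Field F] (n : ℕ) (h : F[X]) :
    Submodule F (Fin n → F) :=
  (idealOf n (-1 : F) ((X ^ n - C (-1 : F)) / h)).comap (toQuot n (-1 : F))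

/-- The ternary code `C(ρ)`: the negacyclic code of length `2ρ` whose check polynomial is the
minimal polynomial of `β` over `GF(3)`. -/
noncomputable def codeRho {K : Type*} [Field K] [Algebra (ZMod 3) K] (ρ : ℕ) (β : K) :
    Submodule (ZMod 3) (Fin (2 * ρ) → ZMod 3) :=
  negacyclicCode (2 * ρ) (minpoly (ZMod 3) β)

/-- The code of length `ρ` over `E` consisting of the words
`(Tr_{K/E}(a θ ^ (2 i)))`, `0 ≤ i ≤ ρ - 1`, for `a ∈ K`, where `θ = β⁻¹`. -/
noncomputable def codeRhoBar (E : Type*) {K : Type*} [Field E] [Field K] [Algebra E K]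
    (ρ : ℕ) (β : K) : Submodule E (Fin ρ → E) :=
  LinearMap.range (LinearMap.pi fun i : Fin ρ =>
    Algebra.trace E K ∘ₗ LinearMap.mulRight E (β⁻¹ ^ (2 * (i : ℕ))))

end NegacyclicCodes

/-! Put `θ = β⁻¹`. The order condition gives `GF(3)(β) = K`, and `C(ρ)` is then exactly the set of
words `Tr(a θ^i)`, `a ∈ K`. Such words lie in the code, `a ↦ (Tr(a θ^i))` is injective because the
powers of `θ` span `K`, and the code has dimension at most `deg (minpoly β) = [K : GF(3)]`.

Since `θ^ρ` is a square root of `-1`, it is the image of some `ι ∈ GF(9)`. The ternary symbols at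
`2i` and `2i + ρ` (up to sign, modulo `2ρ`) are the traces to `GF(3)` of `z` and `ι z`, where `z` is
the `i`-th symbol of the word over `GF(9)` with the same `a`. If `z ≠ 0`, one of them is nonzero, so
passing to `GF(9)` does not increase the weight.

For the square root bound, `-θ²` is a primitive `ρ`-th root of unity. Up to signs a word over
`GF(9)` is a sum of additive characters of `ZMod ρ` with frequencies `9^k`, which are squares, as in
a quadratic residue code. A Gleason–Prange type transformation `f(x) = χ(x) c(t - 1/x)` sends a
support point `t` of `c` to infinity, which gains the `+1`. The Fourier transform of `f` vanishes on
one quadratic class (Salié sums) but not at `0` (Gauss sum), so `supp f + n · supp f` is all of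
`ZMod ρ` for a non-residue `n`. -/

open Polynomial

namespace NegacyclicCodes

/-! ### Character sums and the square root bound. -/

section SqrtBound

variable {k R : Type*} [Field k] [CommRing R]

theorem isQuadratic_apply_inv {χ : MulChar k R} (hχ : χ.IsQuadratic) (x : k) : χ x⁻¹ = χ x := by
  rw [← MulChar.inv_apply' χ x, hχ.inv]

theorem isQuadratic_apply_mul_self {χ : MulChar k R} (hχ : χ.IsQuadratic) {x : k} (hx : x ≠ 0) :
    χ x * χ x = 1 := by
  nth_rewrite 2 [← isQuadratic_apply_inv hχ x]
  rw [← map_mul, mul_inv_cancel₀ hx, map_one]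

variable [Fintype k] [IsDomain R]

/-- The Salié sum `∑ χ(x) ψ(a x + b / x)` vanishes if `a b` is a non-residue. -/
theorem salieSum_eq_zero {χ : MulChar k R} (hχ : χ.IsQuadratic) (ψ : AddChar k R)
    (h2 : (2 : R) ≠ 0) {a b : k} (hab : χ (a * b) = -1) :
    ∑ x, χ x * ψ (a * x + b * x⁻¹) = 0 := by
  have hab0 : a * b ≠ 0 := by
    intro h
    rw [h, MulChar.map_zero] at hab
    have : (1 : R) = 0 := by linear_combination hab
    exact one_ne_zero this
  have ha : a ≠ 0 := left_ne_zero_of_mul hab0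
  have hb : b ≠ 0 := right_ne_zero_of_mul hab0
  -- The substitution `x ↦ b / (a x)` swaps the two terms inside `ψ` and multiplies `χ` by `χ(b / a)
  -- = χ(a b) = -1`, so the sum equals its own negative.
  have hinv : Function.Involutive fun x : k => b * a⁻¹ * x⁻¹ := by
    intro x
    rcases eq_or_ne x 0 with rfl | hx
    · simp
    · simp only; field_simp
  have hχu : χ (b * a⁻¹) = -1 := by
    rw [map_mul, isQuadratic_apply_inv hχ, ← map_mul, mul_comm, hab]
  have key : ∑ x, χ x * ψ (a * x + b * x⁻¹) = ∑ x, -(χ x * ψ (a * x + b * x⁻¹)) := by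
    refine (Equiv.sum_comp hinv.toPerm fun x => χ x * ψ (a * x + b * x⁻¹)).symm.trans ?_
    refine Finset.sum_congr rfl fun x _ => ?_
    simp only [Function.Involutive.coe_toPerm]
    rcases eq_or_ne x 0 with rfl | hx
    · simp [MulChar.map_zero]
    · have h1 : a * (b * a⁻¹ * x⁻¹) + b * (b * a⁻¹ * x⁻¹)⁻¹ = a * x + b * x⁻¹ := by
        field_simp; ring
      rw [h1, map_mul, hχu, isQuadratic_apply_inv hχ]
      ring
  rw [Finset.sum_neg_distrib] at key
  have : 2 * ∑ x, χ x * ψ (a * x + b * x⁻¹) = 0 := by linear_combination key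
  exact (mul_eq_zero.mp this).resolve_left h2

/-- The square root bound: if the Fourier transform of `f` vanishes at all `j` with `χ (-j) = -1`
but not at `0`, then the support of `f` has at least `√|k|` elements. -/
theorem card_le_card_support_sq [DecidableEq R] {χ : MulChar k R} (hχ : χ.IsQuadratic)
    (hχ1 : χ ≠ 1) {ψ : AddChar k R} (hψ : ψ.IsPrimitive) (f : k → R)
    (hf : ∀ j, χ (-j) = -1 → ∑ x, f x * ψ (j * x) = 0) (hf0 : ∑ x, f x ≠ 0) :
    Fintype.card k ≤ (Finset.univ.filter fun x => f x ≠ 0).card ^ 2 := by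
  classical
  obtain ⟨n, hn⟩ : ∃ n, χ n = -1 := by
    obtain ⟨u, hu⟩ := MulChar.ne_one_iff.mp hχ1
    refine ⟨u, ?_⟩
    rcases hχ u with h | h | h
    · exact absurd h (u.isUnit.map χ).ne_zero
    · exact absurd h hu
    · exact h
  set S := Finset.univ.filter fun x => f x ≠ 0 with hS
  -- For `j ≠ 0`, one of `-j`, `-n j` is a non-residue, so the product of the transforms of `f` at
  -- `j` and `n j` is supported at `j = 0`. By Fourier inversion the convolution of `f` with its
  -- `n`-dilate is a nonzero constant, hence every `t` has the form `x + n y` with `x, y ∈ S`.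
  have hsurj : Finset.univ ⊆ (S ×ˢ S).image fun q => q.1 + n * q.2 := by
    intro t _
    by_contra ht
    have hne : ∀ x y, f x ≠ 0 → f y ≠ 0 → x + n * y - t ≠ 0 := by
      intro x y hx hy h
      refine ht (Finset.mem_image.mpr ⟨(x, y), ?_, ?_⟩)
      · simp [hS, hx, hy]
      · simpa [sub_eq_zero] using h
    have h1 : ∑ j, ψ (j * -t) * ((∑ x, f x * ψ (j * x)) * ∑ y, f y * ψ (n * j * y)) = 0 := by
      have : ∀ j, ψ (j * -t) * ((∑ x, f x * ψ (j * x)) * ∑ y, f y * ψ (n * j * y)) =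
          ∑ x, ∑ y, f x * f y * ψ (j * (x + n * y - t)) := by
        intro j
        rw [Finset.sum_mul_sum, Finset.mul_sum]
        refine Finset.sum_congr rfl fun x _ => ?_
        rw [Finset.mul_sum]
        refine Finset.sum_congr rfl fun y _ => ?_
        rw [show j * (x + n * y - t) = j * -t + j * x + n * j * y by ring,
          AddChar.map_add_eq_mul, AddChar.map_add_eq_mul]
        ring
      rw [Finset.sum_congr rfl fun j _ => this j, Finset.sum_comm]
      refine Finset.sum_eq_zero fun x _ => ?_
      rw [Finset.sum_comm]
      refine Finset.sum_eq_zero fun y _ => ?_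
      rw [← Finset.mul_sum, AddChar.sum_mulShift _ hψ]
      by_cases hx : f x = 0
      · simp [hx]
      by_cases hy : f y = 0
      · simp [hy]
      simp [hne x y hx hy]
    rw [Finset.sum_eq_single 0] at h1
    · simp only [zero_mul, mul_zero, AddChar.map_zero_eq_one, mul_one, one_mul] at h1
      exact mul_ne_zero hf0 hf0 h1
    · intro j _ hj
      rcases hχ (-j) with h | h | h
      · exact absurd h ((neg_ne_zero.mpr hj).isUnit.map χ).ne_zero
      · rw [hf (n * j)]
        · ring
        · rw [show -(n * j) = n * -j by ring, map_mul, hn, h, mul_one]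
      · rw [hf j h]
        ring
    · simp
  calc Fintype.card k = (Finset.univ : Finset k).card := rfl
    _ ≤ _ := Finset.card_le_card hsurj
    _ ≤ _ := Finset.card_image_le
    _ = _ := by rw [Finset.card_product, sq]

/-- The square root bound for words whose frequencies are quadratic residues. -/
theorem card_le_card_support_sub_one_sq [DecidableEq R] {χ : MulChar k R} (hχ : χ.IsQuadratic)
    (hχ1 : χ ≠ 1) {ψ : AddChar k R} (hψ : ψ.IsPrimitive) (h2 : (2 : R) ≠ 0)
    (hcard : (Fintype.card k : R) ≠ 0) {ι : Type*} [Fintype ι] (a : ι → R) (r : ι → k)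
    (hr : ∀ i, χ (r i) = 1) (hc : (fun x => ∑ i, a i * ψ (r i * x)) ≠ 0) :
    Fintype.card k ≤
      ((Finset.univ.filter fun x => ∑ i, a i * ψ (r i * x) ≠ 0).card - 1) ^ 2 := by
  classical
  obtain ⟨t, ht⟩ := Function.ne_iff.mp hc
  simp only [Pi.zero_apply] at ht
  set c : k → R := fun x => ∑ i, a i * ψ (r i * x) with hcdef
  -- The transform of `f` at `j` combines Salié sums with parameters `j` and `-r i`; as `χ (r i) =
  -- 1`, they vanish when `χ (-j) = -1`. At `j = 0` they degenerate to Gauss sums.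
  set f : k → R := fun x => χ x * c (t - x⁻¹) with hfdef
  have hfj : ∀ j x, f x * ψ (j * x) =
      ∑ i, a i * ψ (r i * t) * (χ x * ψ (j * x + -r i * x⁻¹)) := by
    intro j x
    simp only [hfdef, hcdef]
    rw [Finset.mul_sum, Finset.sum_mul]
    refine Finset.sum_congr rfl fun i _ => ?_
    rw [show r i * (t - x⁻¹) = r i * t + -r i * x⁻¹ by ring, AddChar.map_add_eq_mul,
      AddChar.map_add_eq_mul]
    ring
  have hf : ∀ j, χ (-j) = -1 → ∑ x, f x * ψ (j * x) = 0 := by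
    intro j hj
    rw [Finset.sum_congr rfl fun x _ => hfj j x, Finset.sum_comm]
    refine Finset.sum_eq_zero fun i _ => ?_
    rw [← Finset.mul_sum, salieSum_eq_zero hχ ψ h2, mul_zero]
    rw [show j * -r i = -j * r i by ring, map_mul, hj, hr, mul_one]
  have hG : gaussSum χ ψ ≠ 0 := gaussSum_ne_zero_of_nontrivial hcard hχ1 hψ
  have hf0 : ∑ x, f x = χ (-1) * gaussSum χ ψ * c t := by
    have h1 : ∀ i, ∑ x, χ x * ψ (0 * x + -r i * x⁻¹) = χ (-1) * gaussSum χ ψ := by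
      intro i
      have hri : r i ≠ 0 := by
        intro h
        have := hr i
        rw [h, MulChar.map_zero] at this
        exact zero_ne_one this
      have hu : IsUnit (-r i) := (neg_ne_zero.mpr hri).isUnit
      have h2 := gaussSum_mulShift χ ψ hu.unit
      rw [← h2]
      have h3 : χ (hu.unit : k) = χ (-1) := by
        rw [IsUnit.unit_spec, neg_eq_neg_one_mul, map_mul, hr, mul_one]
      rw [h3, ← mul_assoc, isQuadratic_apply_mul_self hχ (neg_ne_zero.mpr one_ne_zero), one_mul,
        gaussSum, ← Equiv.sum_comp (Equiv.inv k)]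
      refine Finset.sum_congr rfl fun x _ => ?_
      simp [isQuadratic_apply_inv hχ, AddChar.mulShift_apply]
    have h2 : ∀ x, f x = f x * ψ (0 * x) := fun x => by simp
    rw [Finset.sum_congr rfl fun x _ => (h2 x).trans (hfj 0 x), Finset.sum_comm]
    simp only [← Finset.mul_sum, h1]
    rw [← Finset.sum_mul, mul_comm]
  have hbound := card_le_card_support_sq hχ hχ1 hψ f hf (by
    rw [hf0]
    exact mul_ne_zero (mul_ne_zero ((neg_ne_zero.mpr one_ne_zero).isUnit.map χ).ne_zero hG) ht)
  refine hbound.trans (Nat.pow_le_pow_left ?_ 2)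
  have htS : t ∈ Finset.univ.filter fun x => c x ≠ 0 := by simpa using ht
  rw [← Finset.card_erase_of_mem htS]
  -- The factor `χ x` kills `x = 0`, the only point sent to `t`; so `t` is lost from the support.
  refine Finset.card_le_card_of_injOn (fun x => t - x⁻¹) ?_ ?_
  · intro x hx
    have hx' : χ x * c (t - x⁻¹) ≠ 0 := by simpa [hfdef] using hx
    have hx0 : x ≠ 0 := by
      rintro rfl
      exact hx' (by rw [MulChar.map_zero, zero_mul])
    simp only [Finset.coe_erase, Set.mem_sdiff, Finset.mem_coe, Finset.mem_filter,
      Finset.mem_univ, true_and, Set.mem_singleton_iff]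
    exact ⟨right_ne_zero_of_mul hx', by simpa using hx0⟩
  · intro x _ y _ hxy
    simpa using hxy

end SqrtBound

/-! ### Constacyclic codes and their generator and check polynomials. -/

section Constacyclic

variable {F : Type*} [Field F] {n : ℕ}

theorem wordPoly_apply (c : Fin n → F) : wordPoly F n c = ∑ i : Fin n, monomial (i : ℕ) (c i) := by
  simp [wordPoly]

theorem coeff_wordPoly (c : Fin n → F) (i : Fin n) : (wordPoly F n c).coeff i = c i := by
  rw [wordPoly_apply, finsetSum_coeff, Finset.sum_eq_single i]
  · simp
  · intro j _ hj
    rw [coeff_monomial, if_neg fun h => hj (Fin.ext h)]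
  · simp

theorem degree_wordPoly_lt (c : Fin n → F) : (wordPoly F n c).degree < n := by
  rw [wordPoly_apply, ← mem_degreeLT]
  exact Submodule.sum_mem _ fun i _ =>
    mem_degreeLT.mpr ((degree_monomial_le _ _).trans_lt (by exact_mod_cast i.isLt))

theorem wordPoly_coeff {p : F[X]} (hp : p.degree < n) :
    wordPoly F n (fun i => p.coeff i) = p := by
  ext m
  by_cases hm : m < n
  · exact coeff_wordPoly _ ⟨m, hm⟩
  · have hm' : (n : WithBot ℕ) ≤ m := by exact_mod_cast not_lt.mp hm
    rw [coeff_eq_zero_of_degree_lt ((degree_wordPoly_lt _).trans_le hm'),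
      coeff_eq_zero_of_degree_lt (hp.trans_le hm')]

theorem toQuot_apply (l : F) (c : Fin n → F) :
    toQuot n l c = AdjoinRoot.mk (X ^ n - C l) (wordPoly F n c) := rfl

theorem toQuot_surjective (hn : n ≠ 0) (l : F) : Function.Surjective (toQuot n l) := by
  intro q
  obtain ⟨p, rfl⟩ := AdjoinRoot.mk_surjective q
  refine ⟨fun i => (p %ₘ (X ^ n - C l)).coeff i, ?_⟩
  rw [toQuot_apply, wordPoly_coeff, AdjoinRoot.mk_eq_mk]
  · exact ⟨-(p /ₘ (X ^ n - C l)), by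
      linear_combination modByMonic_add_div p (X ^ n - C l)⟩
  · have := degree_modByMonic_lt p (monic_X_pow_sub_C l hn)
    rwa [degree_X_pow_sub_C (Nat.pos_of_ne_zero hn)] at this

theorem wordPoly_constaShift (l : F) (c : Fin n → F) (hn : n ≠ 0) :
    X * wordPoly F n c - wordPoly F n (constaShift l c) =
      C (c ⟨n - 1, by omega⟩) * (X ^ n - C l) := by
  obtain ⟨m, rfl⟩ := Nat.exists_eq_succ_of_ne_zero hn
  rw [wordPoly_apply, wordPoly_apply, Fin.sum_univ_castSucc, Fin.sum_univ_succ]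
  have h1 : ∀ i : Fin m, constaShift l c i.succ = c i.castSucc := fun i => by
    simp [constaShift, Fin.castSucc, Fin.castAdd, Fin.castLE]
  have h0 : constaShift l c 0 = l * c (Fin.last m) := by simp [constaShift, Fin.last]
  have h2 : ∀ i : Fin m, X * monomial (i.castSucc : ℕ) (c i.castSucc) =
      monomial (i.succ : ℕ) (constaShift l c i.succ) := fun i => by
    rw [h1, X_mul_monomial]; rfl
  rw [mul_add, Finset.mul_sum, Finset.sum_congr rfl fun i _ => h2 i, h0, X_mul_monomial,
    Fin.val_last, Fin.val_zero, monomial_zero_left, ← C_mul_X_pow_eq_monomial]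
  have h3 : c ⟨m.succ - 1, by omega⟩ = c (Fin.last m) := rfl
  rw [h3, C_mul, pow_succ]
  ring

theorem toQuot_mem_idealOf {l : F} {g : F[X]} (hg : g ∣ X ^ n - C l) (c : Fin n → F) :
    toQuot n l c ∈ idealOf n l g ↔ g ∣ wordPoly F n c := by
  rw [toQuot_apply, idealOf, Submodule.restrictScalars_mem, Ideal.mem_span_singleton]
  constructor
  · rintro ⟨q, hq⟩
    obtain ⟨q, rfl⟩ := AdjoinRoot.mk_surjective q
    rw [← map_mul, AdjoinRoot.mk_eq_mk] at hq
    have := dvd_add (hg.trans hq) (dvd_mul_right g q)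
    rwa [sub_add_cancel] at this
  · exact map_dvd _

/-- The code with generator polynomial `g` is constacyclic. -/
theorem isConstacyclic_comap_idealOf (l : F) (g : F[X]) :
    IsConstacyclic l ((idealOf n l g).comap (toQuot n l)) := by
  intro c hc
  rcases eq_or_ne n 0 with rfl | hn
  · convert hc
  have h : toQuot n l (constaShift l c) = AdjoinRoot.mk (X ^ n - C l) X * toQuot n l c := by
    rw [toQuot_apply, toQuot_apply, ← map_mul, eq_comm, AdjoinRoot.mk_eq_mk,
      wordPoly_constaShift l c hn]
    exact dvd_mul_left _ _
  rw [Submodule.mem_comap, h]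
  exact Ideal.mul_mem_left _ _ hc

theorem isGeneratorPolynomial_comap_idealOf (hn : n ≠ 0) {l : F} {g : F[X]} (hg : g.Monic)
    (hgd : g ∣ X ^ n - C l) :
    IsGeneratorPolynomial l ((idealOf n l g).comap (toQuot n l)) g := by
  have hmap := Submodule.map_comap_eq_of_surjective (toQuot_surjective hn l) (idealOf n l g)
  refine ⟨⟨hg, hmap⟩, fun g' hg' h => ?_⟩
  rw [hmap] at h
  have hmem : AdjoinRoot.mk (X ^ n - C l) g' ∈ idealOf n l g := by
    rw [h]
    exact Ideal.mem_span_singleton_self _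
  obtain ⟨q, hq⟩ := Ideal.mem_span_singleton.mp hmem
  obtain ⟨q, rfl⟩ := AdjoinRoot.mk_surjective q
  rw [← map_mul, AdjoinRoot.mk_eq_mk] at hq
  have := dvd_add (hgd.trans hq) (dvd_mul_right g q)
  rw [sub_add_cancel] at this
  exact natDegree_le_of_dvd this hg'.ne_zero

theorem div_mul_cancel_of_dvd {f h : F[X]} (hdvd : h ∣ f) : f / h * h = f := by
  rcases eq_or_ne h 0 with rfl | hh
  · rw [mul_zero, zero_dvd_iff.mp hdvd]
  · rw [mul_comm, EuclideanDomain.mul_div_cancel' hh hdvd]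

theorem isCheckPolynomial_negacyclicCode (hn : n ≠ 0) {h : F[X]} (hh : h.Monic)
    (hdvd : h ∣ X ^ n - C (-1 : F)) : IsCheckPolynomial (-1) (negacyclicCode n h) h := by
  have hmul := div_mul_cancel_of_dvd hdvd
  refine ⟨_, isGeneratorPolynomial_comap_idealOf hn ?_ ⟨h, hmul.symm⟩, hmul⟩
  refine hh.of_mul_monic_right ?_
  rw [hmul]
  exact monic_X_pow_sub_C _ hn

theorem mem_negacyclicCode {h : F[X]} (hdvd : h ∣ X ^ n - C (-1 : F)) (c : Fin n → F) :
    c ∈ negacyclicCode n h ↔ (X ^ n - C (-1 : F)) / h ∣ wordPoly F n c :=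
  toQuot_mem_idealOf ⟨h, (div_mul_cancel_of_dvd hdvd).symm⟩ c

/-- Each codeword is `g q` with `deg q < deg h`. The upper bound suffices: the trace words supply
the reverse inequality. -/
theorem finrank_negacyclicCode_le (hn : n ≠ 0) {h : F[X]} (hdvd : h ∣ X ^ n - C (-1 : F)) :
    Module.finrank F (negacyclicCode n h) ≤ h.natDegree := by
  set g := (X ^ n - C (-1 : F)) / h
  have hgh : g * h = X ^ n - C (-1 : F) := div_mul_cancel_of_dvd hdvd
  have hmem : ∀ c ∈ negacyclicCode n h, g ∣ wordPoly F n c :=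
    fun c hc => (mem_negacyclicCode hdvd c).mp hc
  clear_value g
  have hne : g * h ≠ 0 := by
    rw [hgh]
    exact (monic_X_pow_sub_C _ hn).ne_zero
  let L : degreeLT F h.natDegree →ₗ[F] (Fin n → F) :=
    LinearMap.pi fun i => lcoeff F i ∘ₗ LinearMap.mulLeft F g ∘ₗ (degreeLT F h.natDegree).subtype
  have hle : negacyclicCode n h ≤ LinearMap.range L := by
    intro c hc
    obtain ⟨q, hq⟩ := hmem c hc
    have hqd : q ∈ degreeLT F h.natDegree := by
      rw [mem_degreeLT]
      rcases eq_or_ne q 0 with rfl | hq0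
      · rw [degree_zero]; exact WithBot.bot_lt_coe _
      have h1 := degree_wordPoly_lt c
      rw [hq, ← degree_X_pow_sub_C (Nat.pos_of_ne_zero hn) (-1 : F), ← hgh] at h1
      rw [degree_eq_natDegree (mul_ne_zero (left_ne_zero_of_mul hne) hq0),
        degree_eq_natDegree hne, natDegree_mul (left_ne_zero_of_mul hne) hq0,
        natDegree_mul (left_ne_zero_of_mul hne) (right_ne_zero_of_mul hne)] at h1
      rw [degree_eq_natDegree hq0]
      have h2 : g.natDegree + q.natDegree < g.natDegree + h.natDegree := by exact_mod_cast h1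
      exact_mod_cast lt_of_add_lt_add_left h2
    refine ⟨⟨q, hqd⟩, ?_⟩
    ext i
    rw [← coeff_wordPoly c i, hq]
    rfl
  have : FiniteDimensional F (degreeLT F h.natDegree) :=
    (degreeLTEquiv F h.natDegree).symm.finiteDimensional
  calc _ ≤ Module.finrank F (LinearMap.range L) := Submodule.finrank_mono hle
    _ ≤ Module.finrank F (degreeLT F h.natDegree) := LinearMap.finrank_range_le L
    _ = h.natDegree := by rw [(degreeLTEquiv F h.natDegree).finrank_eq]; simp

end Constacyclic

/-! ### Trace description of irreducible negacyclic codes. -/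

section TraceCode

variable {F K : Type*} [Field F] [Field K] [Algebra F K]

/-- The polynomial obtained by applying the trace to each coefficient. -/
noncomputable def traceCoeff (F : Type*) {K : Type*} [Field F] [Field K] [Algebra F K]
    (p : K[X]) : F[X] :=
  ∑ i ∈ p.support, monomial i (Algebra.trace F K (p.coeff i))

theorem coeff_traceCoeff (p : K[X]) (m : ℕ) :
    (traceCoeff F p).coeff m = Algebra.trace F K (p.coeff m) := by
  rw [traceCoeff, finsetSum_coeff]
  simp only [coeff_monomial, Finset.sum_ite_eq', mem_support_iff]
  by_cases h : p.coeff m = 0 <;> simp [h]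

theorem traceCoeff_map_mul (f : F[X]) (p : K[X]) :
    traceCoeff F (f.map (algebraMap F K) * p) = f * traceCoeff F p := by
  ext m
  rw [coeff_traceCoeff, coeff_mul, coeff_mul, map_sum]
  refine Finset.sum_congr rfl fun x _ => ?_
  rw [coeff_map, ← Algebra.smul_def, map_smul, coeff_traceCoeff, smul_eq_mul]

/-- The map `a ↦ (Tr(a θ ^ i))`, `0 ≤ i < n`. -/
noncomputable def traceWord (F : Type*) {K : Type*} [Field F] [Field K] [Algebra F K] (n : ℕ)
    (θ : K) : K →ₗ[F] (Fin n → F) :=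
  LinearMap.pi fun i => Algebra.trace F K ∘ₗ LinearMap.mulRight F (θ ^ (i : ℕ))

theorem traceWord_apply (n : ℕ) (θ a : K) (i : Fin n) :
    traceWord F n θ a i = Algebra.trace F K (a * θ ^ (i : ℕ)) := rfl

theorem wordPoly_traceWord (n : ℕ) (θ a : K) :
    wordPoly F n (traceWord F n θ a) =
      traceCoeff F (C a * ∑ i ∈ Finset.range n, (C θ * X) ^ i) := by
  have h : ∀ m, (C a * ∑ i ∈ Finset.range n, (C θ * X) ^ i).coeff m =
      if m < n then a * θ ^ m else 0 := fun m => by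
    simp_rw [mul_pow, ← C_pow, coeff_C_mul, finsetSum_coeff, coeff_C_mul, coeff_X_pow]
    simp
  ext m
  rw [coeff_traceCoeff, h]
  split_ifs with hm
  · exact coeff_wordPoly _ ⟨m, hm⟩
  · rw [map_zero]
    exact coeff_eq_zero_of_degree_lt
      ((degree_wordPoly_lt _).trans_le (by exact_mod_cast not_lt.mp hm))

theorem minpoly_dvd_of_pow_eq {n : ℕ} {β : K} (hβ : β ^ n = -1) :
    minpoly F β ∣ X ^ n - C (-1 : F) := by
  refine minpoly.dvd _ _ ?_
  simp [hβ]

theorem traceWord_mem_negacyclicCode {n : ℕ} {β : K} (hβ : β ^ n = -1) (a : K) :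
    traceWord F n β⁻¹ a ∈ negacyclicCode n (minpoly F β) := by
  have hdvd := minpoly_dvd_of_pow_eq (F := F) hβ
  rcases eq_or_ne n 0 with rfl | hn
  · convert Submodule.zero_mem _
  have hβ0 : β ≠ 0 := by
    rintro rfl
    rw [zero_pow hn] at hβ
    exact one_ne_zero (neg_eq_zero.mp hβ.symm)
  rw [mem_negacyclicCode hdvd]
  have hgh := div_mul_cancel_of_dvd hdvd
  have hne : minpoly F β ≠ 0 := by
    intro h
    rw [h, mul_zero] at hgh
    exact (monic_X_pow_sub_C (-1 : F) hn).ne_zero hgh.symm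
  obtain ⟨q, hq⟩ : X - C β ∣ (minpoly F β).map (algebraMap F K) := by
    rw [dvd_iff_isRoot, IsRoot, eval_map_algebraMap, minpoly.aeval]
  have hgeom := mul_geom_sum (C β⁻¹ * X : K[X]) n
  rw [mul_pow, ← C_pow, inv_pow, hβ] at hgeom
  have hCβ : (C β * C β⁻¹ : K[X]) = 1 := by rw [← C_mul, mul_inv_cancel₀ hβ0, C_1]
  have hinv : (C (-1)⁻¹ : K[X]) = -1 := by simp
  rw [hinv] at hgeom
  -- As `(β⁻¹ X)^n = -X^n`, the geometric sum is `-β (X^n + 1) / (X - β)`, and `X - β` divides the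
  -- minimal polynomial. Taking traces of coefficients, which is `F[X]`-linear, brings the identity
  -- down to `F`.
  have hkey : (minpoly F β).map (algebraMap F K) *
      (C a * ∑ i ∈ Finset.range n, (C β⁻¹ * X) ^ i) =
      (X ^ n - C (-1 : F)).map (algebraMap F K) * -(C a * C β * q) := by
    rw [hq]
    simp only [Polynomial.map_sub, Polynomial.map_pow, map_X, Polynomial.map_neg, Polynomial.map_one, C_neg, C_1]
    linear_combination (C a * C β * q) * hgeom -
      (C a * q * X * ∑ i ∈ Finset.range n, (C β⁻¹ * X) ^ i) * hCβ
  have h := congrArg (traceCoeff F) hkey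
  rw [traceCoeff_map_mul, traceCoeff_map_mul, ← wordPoly_traceWord, ← hgh] at h
  refine (mul_dvd_mul_iff_left hne).mp ⟨traceCoeff F (-(C a * C β * q)), ?_⟩
  rw [h, mul_comm (minpoly F β)]

theorem pow_eq_neg_one_pow_mul {n : ℕ} {θ : K} (hθ : θ ^ n = -1) (m : ℕ) :
    θ ^ m = (-1) ^ (m / n) * θ ^ (m % n) := by
  conv_lhs => rw [← Nat.div_add_mod m n, pow_add, pow_mul, hθ]

theorem trace_mul_neg_one_pow_mul (a b : K) (k : ℕ) :
    Algebra.trace F K (a * ((-1) ^ k * b)) = (-1) ^ k * Algebra.trace F K (a * b) := by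
  rcases neg_one_pow_eq_or K k with h | h <;> rcases Nat.even_or_odd k with hk | hk <;>
    simp [hk.neg_one_pow]

theorem trace_mul_pow_eq_zero {n : ℕ} (hn : n ≠ 0) {θ : K} (hθ : θ ^ n = -1) {a : K}
    (ha : traceWord F n θ a = 0) (m : ℕ) : Algebra.trace F K (a * θ ^ m) = 0 := by
  rw [pow_eq_neg_one_pow_mul hθ, trace_mul_neg_one_pow_mul]
  have := congrFun ha ⟨m % n, Nat.mod_lt _ (Nat.pos_of_ne_zero hn)⟩
  rw [traceWord_apply] at this
  rw [this, Pi.zero_apply, mul_zero]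

theorem traceWord_injective [FiniteDimensional F K] [Algebra.IsSeparable F K] {n : ℕ}
    (hn : n ≠ 0) {θ : K} (hθ : θ ^ n = -1) (hadj : IntermediateField.adjoin F {θ} = ⊤) :
    Function.Injective (traceWord F n θ) := by
  rw [← LinearMap.ker_eq_bot, LinearMap.ker_eq_bot']
  intro a ha
  refine (traceForm_nondegenerate F K).1 a fun y => ?_
  rw [Algebra.traceForm_apply]
  have hy : y ∈ Algebra.adjoin F {θ} := by
    rw [← IntermediateField.adjoin_simple_toSubalgebra_of_isAlgebraic
      (Algebra.IsAlgebraic.isAlgebraic θ), hadj]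
    trivial
  rw [Algebra.adjoin_singleton_eq_range_aeval] at hy
  obtain ⟨p, rfl⟩ := hy
  change Algebra.trace F K (a * aeval θ p) = 0
  rw [aeval_eq_sum_range, Finset.mul_sum, map_sum]
  refine Finset.sum_eq_zero fun i _ => ?_
  rw [mul_smul_comm, map_smul, trace_mul_pow_eq_zero hn hθ ha, smul_zero]

theorem isNegacyclic_range_traceWord {n : ℕ} {θ : K} (hθ : θ ^ n = -1) :
    IsNegacyclic (LinearMap.range (traceWord F n θ)) := by
  rintro _ ⟨a, rfl⟩
  -- Shifting the word divides `a` by `θ`; the wrap-around sign comes from `θ^n = -1`.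
  refine ⟨a * θ⁻¹, ?_⟩
  ext i
  have hn : n ≠ 0 := fun h => (h ▸ i).elim0
  have hθ0 : θ ≠ 0 := by
    rintro rfl
    rw [zero_pow hn] at hθ
    exact one_ne_zero (neg_eq_zero.mp hθ.symm)
  rw [constaShift, traceWord_apply]
  split_ifs with h
  · rw [traceWord_apply, h, neg_one_mul, ← map_neg]
    obtain ⟨m, rfl⟩ := Nat.exists_eq_succ_of_ne_zero hn
    rw [pow_succ] at hθ
    simp only [Nat.succ_sub_one]
    congr 1
    field_simp
    linear_combination a * hθ
  · rw [traceWord_apply]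
    obtain ⟨m, hm⟩ := Nat.exists_eq_succ_of_ne_zero h
    simp only [hm, Nat.succ_sub_one, pow_succ]
    congr 1
    field_simp

theorem finrank_negacyclicCode_and_eq_range [FiniteDimensional F K] [Algebra.IsSeparable F K]
    {n : ℕ} (hn : n ≠ 0) {β : K} (hβ : β ^ n = -1)
    (hadj : IntermediateField.adjoin F {β} = ⊤) :
    negacyclicCode n (minpoly F β) = LinearMap.range (traceWord F n β⁻¹) ∧
      Module.finrank F (negacyclicCode n (minpoly F β)) = Module.finrank F K := by
  have hθ : β⁻¹ ^ n = -1 := by rw [inv_pow, hβ, inv_neg_one]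
  have hadj' : IntermediateField.adjoin F {β⁻¹} = ⊤ := by
    rw [eq_top_iff, ← hadj, IntermediateField.adjoin_simple_le_iff]
    have := inv_mem (IntermediateField.mem_adjoin_simple_self F β⁻¹)
    rwa [inv_inv] at this
  have hr := LinearMap.finrank_range_of_inj (traceWord_injective (F := F) hn hθ hadj')
  have hle : LinearMap.range (traceWord F n β⁻¹) ≤ negacyclicCode n (minpoly F β) := by
    rintro _ ⟨a, rfl⟩
    exact traceWord_mem_negacyclicCode hβ a
  have hub := finrank_negacyclicCode_le hn (minpoly_dvd_of_pow_eq (F := F) hβ)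
  have hdeg : (minpoly F β).natDegree = Module.finrank F K := by
    rw [← IntermediateField.adjoin.finrank (Algebra.IsIntegral.isIntegral β), hadj,
      IntermediateField.finrank_top']
  have heq := Submodule.eq_of_le_of_finrank_le hle (by rw [hr, ← hdeg]; exact hub)
  exact ⟨heq.symm, by rw [← heq, hr]⟩

end TraceCode

/-! ### Minimum distance as minimum weight. -/

section MinDist

variable {F : Type*} [Field F] [DecidableEq F] {n : ℕ}

theorem minDist_le_hammingNorm {C : Submodule F (Fin n → F)} {c : Fin n → F} (hc : c ∈ C)
    (h0 : c ≠ 0) : minDist C ≤ hammingNorm c :=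
  Nat.sInf_le ⟨c, hc, 0, C.zero_mem, h0, hammingDist_zero_right c⟩

theorem exists_hammingNorm_eq_minDist {C : Submodule F (Fin n → F)} (hC : C ≠ ⊥) :
    ∃ c ∈ C, c ≠ 0 ∧ hammingNorm c = minDist C := by
  obtain ⟨c, hc, h0⟩ := Submodule.exists_mem_ne_zero_of_ne_bot hC
  obtain ⟨x, hx, y, hy, hxy, h⟩ := Nat.sInf_mem
    (s := {d : ℕ | ∃ x ∈ C, ∃ y ∈ C, x ≠ y ∧ hammingDist x y = d})
    ⟨_, c, hc, 0, C.zero_mem, h0, rfl⟩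
  exact ⟨x - y, C.sub_mem hx hy, sub_ne_zero.mpr hxy, by
    rw [minDist, ← h, hammingDist_comm, hammingDist_eq_hammingNorm, neg_add_eq_sub]⟩

end MinDist

/-! ### The two codes attached to `ρ`. -/

section Rho

theorem codeRhoBar_eq_range (E : Type*) {K : Type*} [Field E] [Field K] [Algebra E K] (ρ : ℕ)
    (β : K) : codeRhoBar E ρ β = LinearMap.range (traceWord E ρ (β⁻¹ ^ 2)) := by
  simp only [codeRhoBar, traceWord, pow_mul]

theorem pow_two_mul_eq_neg_one {K : Type*} [Field K] {ρ : ℕ} (hρ : ρ ≠ 0) {β : K}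
    (hβ : IsPrimitiveRoot β (4 * ρ)) : β ^ (2 * ρ) = -1 := by
  have h1 : (β ^ (2 * ρ)) ^ 2 = 1 := by
    rw [← pow_mul, show 2 * ρ * 2 = 4 * ρ by ring, hβ.pow_eq_one]
  exact (mul_self_eq_one_iff.mp ((sq _).symm.trans h1)).resolve_left
    (hβ.pow_ne_one_of_pos_of_lt (by omega) (by omega))

theorem finrank_of_natCard_eq {p m : ℕ} [Fact p.Prime] {K : Type*} [Field K] [Algebra (ZMod p) K]
    [Finite K] (hK : Nat.card K = p ^ m) : Module.finrank (ZMod p) K = m := by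
  have h := Module.natCard_eq_pow_finrank (K := ZMod p) (V := K)
  rw [hK, Nat.card_zmod] at h
  exact (Nat.pow_right_injective (Fact.out : p.Prime).two_le h).symm

/-- If `β` generates a field of `p^d` elements, then `ρ` divides `p^d - 1`, so `d` is a multiple of
the order `ρ - 1` of `p` modulo `ρ`. -/
theorem adjoin_eq_top_of_orderOf {ρ : ℕ} {p : ℕ} [Fact p.Prime]
    (hord : orderOf (p : ZMod ρ) = ρ - 1) {K : Type*} [Field K] [Finite K] [Algebra (ZMod p) K]
    (hK : Module.finrank (ZMod p) K = ρ - 1) {β : K} (hβ0 : β ≠ 0) {k : ℕ}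
    (hβ : IsPrimitiveRoot β (k * ρ)) :
    IntermediateField.adjoin (ZMod p) {β} = ⊤ := by
  set L := IntermediateField.adjoin (ZMod p) {β}
  have : Fintype L := Fintype.ofFinite L
  refine IntermediateField.eq_of_le_of_finrank_le le_top ?_
  rw [IntermediateField.finrank_top', hK]
  refine Nat.le_of_dvd Module.finrank_pos ?_
  rw [← hord]
  apply orderOf_dvd_of_pow_eq_one
  have hβL : β ∈ L := IntermediateField.mem_adjoin_simple_self _ β
  have h1 : (⟨β, hβL⟩ : L) ^ (Fintype.card L - 1) = 1 :=
    FiniteField.pow_card_sub_one_eq_one _ fun h => hβ0 (congrArg Subtype.val h)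
  have h2 : β ^ (p ^ Module.finrank (ZMod p) L - 1) = 1 := by
    have := congrArg Subtype.val h1
    rwa [← Nat.card_eq_fintype_card, Module.natCard_eq_pow_finrank (K := ZMod p),
      Nat.card_zmod] at this
  have h3 : ρ ∣ p ^ Module.finrank (ZMod p) L - 1 :=
    (dvd_mul_left ρ k).trans (hβ.dvd_of_pow_eq_one _ h2)
  have h4 := (ZMod.natCast_eq_zero_iff _ _).mpr h3
  rw [Nat.cast_sub (Nat.one_le_pow _ _ (Fact.out : p.Prime).pos)] at h4
  push_cast at h4
  exact sub_eq_zero.mp h4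

theorem isPrimitiveRoot_neg_sq {K : Type*} [Field K] {ρ : ℕ} (hρ : ρ.Prime) (hodd : Odd ρ)
    {θ : K} (hθ : IsPrimitiveRoot θ (4 * ρ)) : IsPrimitiveRoot (-θ ^ 2) ρ := by
  have : Fact ρ.Prime := ⟨hρ⟩
  rw [IsPrimitiveRoot.iff_orderOf]
  refine orderOf_eq_prime ?_ fun h => ?_
  · rw [hodd.neg_pow, ← pow_mul, pow_two_mul_eq_neg_one hρ.ne_zero hθ, neg_neg]
  · refine hθ.pow_ne_one_of_pos_of_lt (l := 4) (by norm_num) ?_ ?_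
    · have := hρ.two_le
      omega
    · linear_combination (1 - θ ^ 2) * h

/-- The square root bound for the words of `codeRhoBar`. -/
theorem le_hammingNorm_traceWord_sub_one_sq {E K : Type*} [Field E] [DecidableEq E] [Field K]
    [Finite K] [Algebra E K] {ρ : ℕ} (hρ : ρ.Prime) (hρ2 : ρ ≠ 2) (h2 : (2 : K) ≠ 0)
    {s : ℕ} (hs : Odd s) (hE : Nat.card E = s ^ 2) (hsρ : (s : ZMod ρ) ≠ 0) (hρK : (ρ : K) ≠ 0)
    {θ : K} (hθ : IsPrimitiveRoot θ (4 * ρ)) {a : K} (ha : traceWord E ρ (θ ^ 2) a ≠ 0) :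
    ρ ≤ (hammingNorm (traceWord E ρ (θ ^ 2) a) - 1) ^ 2 := by
  classical
  have : Fact ρ.Prime := ⟨hρ⟩
  have hζ := isPrimitiveRoot_neg_sq hρ (hρ.odd_of_ne_two hρ2) hθ
  set ψ := AddChar.zmodChar ρ hζ.pow_eq_one with hψdef
  have hψ : ψ.IsPrimitive := AddChar.zmodChar_primitive_of_primitive_root ρ hζ
  set χ : MulChar (ZMod ρ) K := (quadraticChar (ZMod ρ)).ringHomComp (Int.castRingHom K) with hχdef
  have hχ : χ.IsQuadratic := (quadraticChar_isQuadratic (ZMod ρ)).comp _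
  have hχ1 : χ ≠ 1 := by
    obtain ⟨x, hx⟩ := quadraticChar_exists_neg_one' (F := ZMod ρ) (by rwa [ZMod.ringChar_zmod_n])
    refine MulChar.ne_one_iff.mpr ⟨x, fun h => h2 ?_⟩
    rw [hχdef, MulChar.ringHomComp_apply, hx] at h
    simp only [map_neg, map_one] at h
    linear_combination -h
  -- Expand the trace into conjugates and write `θ² = -(-θ²)`; the exponents `s^(2k)` are odd, so
  -- each conjugate carries the same sign `(-1)^i`, which does not affect the support.
  have htr : ∀ i : ℕ, algebraMap E K (Algebra.trace E K (a * (θ ^ 2) ^ i)) =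
      (-1) ^ i * ∑ k : Fin (Module.finrank E K),
        a ^ (s ^ 2) ^ (k : ℕ) * ψ ((s : ZMod ρ) ^ (2 * (k : ℕ)) * i) := by
    intro i
    rw [FiniteField.algebraMap_trace_eq_sum_pow, hE, Finset.sum_range, Finset.mul_sum]
    refine Finset.sum_congr rfl fun k _ => ?_
    have h3 : ψ ((s : ZMod ρ) ^ (2 * (k : ℕ)) * i) = ((-θ ^ 2) ^ i) ^ (s ^ 2) ^ (k : ℕ) := by
      rw [← pow_mul, mul_comm i, ← pow_mul, hψdef]
      exact_mod_cast AddChar.zmodChar_apply' hζ.pow_eq_one (s ^ (2 * (k : ℕ)) * i)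
    have h4 : Odd ((s ^ 2) ^ (k : ℕ)) := (hs.pow).pow
    rw [h3, mul_pow, neg_pow (θ ^ 2) i, mul_pow ((-1) ^ i), ← pow_mul (-1 : K), mul_comm i,
      pow_mul (-1 : K), h4.neg_one_pow]
    have h5 : ((-1 : K) ^ i) * (-1) ^ i = 1 := by rw [← mul_pow]; simp
    linear_combination (-(a ^ (s ^ 2) ^ (k : ℕ) * ((θ ^ 2) ^ i) ^ (s ^ 2) ^ (k : ℕ))) * h5
  have hne : ∀ i : ℕ, Algebra.trace E K (a * (θ ^ 2) ^ i) ≠ 0 ↔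
      ∑ k : Fin (Module.finrank E K),
        a ^ (s ^ 2) ^ (k : ℕ) * ψ ((s : ZMod ρ) ^ (2 * (k : ℕ)) * i) ≠ 0 := by
    intro i
    rw [← (algebraMap E K).injective.ne_iff, map_zero, htr, mul_ne_zero_iff]
    simp
  have hbound := card_le_card_support_sub_one_sq hχ hχ1 hψ h2 (by rwa [ZMod.card])
    (fun k : Fin (Module.finrank E K) => a ^ (s ^ 2) ^ (k : ℕ))
    (fun k => (s : ZMod ρ) ^ (2 * (k : ℕ)))
    (fun k => by
      rw [two_mul, pow_add, map_mul]
      exact isQuadratic_apply_mul_self hχ (pow_ne_zero _ hsρ))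
    (by
      obtain ⟨i, hi⟩ := Function.ne_iff.mp ha
      exact Function.ne_iff.mpr ⟨((i : ℕ) : ZMod ρ), (hne i).mp hi⟩)
  rw [ZMod.card] at hbound
  refine hbound.trans (Nat.pow_le_pow_left (Nat.sub_le_sub_right ?_ 1) 2)
  refine Finset.card_le_card_of_injOn (fun x => ⟨x.val, ZMod.val_lt x⟩) ?_ ?_
  · intro x hx
    simp only [Finset.coe_filter, Finset.mem_univ, true_and, Set.mem_ofPred_eq] at hx ⊢
    rw [traceWord_apply, hne]
    simpa using hx
  · intro x _ y _ hxy
    exact ZMod.val_injective ρ (congrArg Fin.val hxy)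

/-! ### Comparing weights over `GF(3)` and `GF(9)`. -/

section Compare

variable {E K : Type*} [Field E] [Field K] [Algebra E K] [Algebra (ZMod 3) E]
  [Algebra (ZMod 3) K] [IsScalarTower (ZMod 3) E K]

/-- The traces are `z + z³` and `ι (z - z³)`; their vanishing forces `2 z = 0` in characteristic 3.
-/
theorem eq_zero_of_trace_eq_zero (hE : Nat.card E = 3 ^ 2) {ι : E} (hι : ι ^ 2 = -1) {z : E}
    (h1 : Algebra.trace (ZMod 3) E z = 0) (h2 : Algebra.trace (ZMod 3) E (ι * z) = 0) : z = 0 := by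
  have : Fact (Nat.Prime 3) := ⟨Nat.prime_three⟩
  have : Finite E := Nat.finite_of_card_ne_zero (by rw [hE]; norm_num)
  have h3 := FiniteField.algebraMap_trace_eq_sum_pow (ZMod 3) E z
  have h4 := FiniteField.algebraMap_trace_eq_sum_pow (ZMod 3) E (ι * z)
  rw [finrank_of_natCard_eq hE, Nat.card_zmod, Finset.sum_range_succ, Finset.sum_range_one,
    pow_zero, pow_one, pow_one] at h3 h4
  rw [h1, map_zero] at h3
  rw [h2, map_zero] at h4
  have hι0 : ι ≠ 0 := by
    rintro rfl
    norm_num at hι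
  have hchar : (3 : E) = 0 := by
    rw [← map_ofNat (algebraMap (ZMod 3) E) 3, show (OfNat.ofNat 3 : ZMod 3) = 0 from rfl, map_zero]
  have h5 : ι * z = 0 := by
    linear_combination ι * h3 + h4 + ι * z * hchar + ι * z ^ 3 * hι
  exact (mul_eq_zero.mp h5).resolve_left hι0

variable [Finite K] {ρ : ℕ} {θ a : K} {ι : E}

theorem hammingNorm_traceWord_le [DecidableEq E] (hE : Nat.card E = 3 ^ 2) (hodd : Odd ρ)
    (hθ : θ ^ (2 * ρ) = -1) (hι : ι ^ 2 = -1) (hιθ : algebraMap E K ι = θ ^ ρ) :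
    hammingNorm (traceWord E ρ (θ ^ 2) a) ≤ hammingNorm (traceWord (ZMod 3) (2 * ρ) θ a) := by
  have hρ0 : 0 < ρ := hodd.pos
  have : Finite E := Nat.finite_of_card_ne_zero (by rw [hE]; norm_num)
  have hex : ∀ i : Fin ρ, ∃ j : Fin (2 * ρ), (j : ℕ) ≡ 2 * i [MOD ρ] ∧
      (traceWord E ρ (θ ^ 2) a i ≠ 0 → traceWord (ZMod 3) (2 * ρ) θ a j ≠ 0) := by
    intro i
    have hmod : ∀ m : ℕ, m ≡ 2 * i [MOD ρ] → Algebra.trace (ZMod 3) K (a * θ ^ m) ≠ 0 →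
        ∃ j : Fin (2 * ρ), (j : ℕ) ≡ 2 * i [MOD ρ] ∧
          traceWord (ZMod 3) (2 * ρ) θ a j ≠ 0 := by
      intro m hm hne
      refine ⟨⟨m % (2 * ρ), Nat.mod_lt _ (by omega)⟩, ?_, ?_⟩
      · exact (Nat.ModEq.of_mul_left 2 (Nat.mod_modEq m (2 * ρ))).trans hm
      · rw [pow_eq_neg_one_pow_mul hθ, trace_mul_neg_one_pow_mul] at hne
        exact right_ne_zero_of_mul hne
    by_cases hz : traceWord E ρ (θ ^ 2) a i = 0
    -- Zero symbols also get a position congruent to `2 i`, so the choice function is injective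
    -- everywhere, `ρ` being odd.
    · refine ⟨⟨2 * i, by omega⟩, Nat.ModEq.refl _, fun h => absurd hz h⟩
    by_cases h0 : Algebra.trace (ZMod 3) K (a * θ ^ (2 * (i : ℕ))) = 0
    · have h1 : Algebra.trace (ZMod 3) K (a * θ ^ (2 * (i : ℕ) + ρ)) ≠ 0 := by
        intro h1
        refine hz (eq_zero_of_trace_eq_zero hE hι ?_ ?_)
        · rw [traceWord_apply, ← pow_mul, Algebra.trace_trace, h0]
        · rw [traceWord_apply, ← pow_mul, ← smul_eq_mul, ← map_smul, Algebra.trace_trace,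
            Algebra.smul_def, hιθ, ← h1, pow_add]
          congr 1
          ring
      obtain ⟨j, hj, hj'⟩ := hmod _ (by simp [Nat.ModEq]) h1
      exact ⟨j, hj, fun _ => hj'⟩
    · obtain ⟨j, hj, hj'⟩ := hmod _ (Nat.ModEq.refl _) h0
      exact ⟨j, hj, fun _ => hj'⟩
  choose f hf hf' using hex
  refine Finset.card_le_card_of_injOn f ?_ ?_
  · intro i hi
    simp only [Finset.coe_filter, Finset.mem_univ, true_and, Set.mem_ofPred_eq] at hi ⊢
    exact hf' i hi
  · intro i _ i' _ h
    have h1 : 2 * (i : ℕ) ≡ 2 * i' [MOD ρ] := (hf i).symm.trans (h ▸ hf i')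
    have hcop : Nat.gcd ρ 2 = 1 := Nat.coprime_two_right.mpr hodd
    exact Fin.ext (Nat.ModEq.eq_of_lt_of_lt (h1.cancel_left_of_coprime hcop) i.isLt i'.isLt)

theorem traceWord_eq_zero_of_sq (hodd : Odd ρ)
    (hθ : θ ^ (2 * ρ) = -1) (hιθ : algebraMap E K ι = θ ^ ρ)
    (h : traceWord E ρ (θ ^ 2) a = 0) : traceWord (ZMod 3) (2 * ρ) θ a = 0 := by
  have : Finite E := Finite.of_injective _ (algebraMap E K).injective
  have hz := trace_mul_pow_eq_zero hodd.pos.ne' (by rw [← pow_mul, hθ]) h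
  ext i
  rw [traceWord_apply, Pi.zero_apply, ← Algebra.trace_trace (S := E)]
  rcases Nat.even_or_odd (i : ℕ) with ⟨m, hm⟩ | hi
  · rw [hm, ← two_mul, pow_mul, hz, map_zero]
  · obtain ⟨m, hm⟩ := hi.add_odd hodd
    -- From `θ^(2ρ) = -1`, `θ^i = -θ^ρ θ^(i+ρ)` with `i + ρ` even.
    have h1 : a * θ ^ (i : ℕ) = -ι • (a * (θ ^ 2) ^ m) := by
      rw [← pow_mul, two_mul m, ← hm, Algebra.smul_def, map_neg, hιθ, pow_add]
      rw [two_mul, pow_add] at hθ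
      linear_combination (a * θ ^ (i : ℕ)) * hθ
    rw [h1, map_smul, hz, smul_zero, map_zero]

end Compare

end Rho

end NegacyclicCodes

theorem mainTheorem1 (ρ : ℕ) (hρ : ρ.Prime) (hρ3 : 3 < ρ)
    (hmod : (ρ : ℤ) ≡ 5 [ZMOD 12] ∨ (ρ : ℤ) ≡ -5 [ZMOD 12])
    (hord : orderOf (3 : ZMod ρ) = ρ - 1)
    {E K : Type*} [Field E] [DecidableEq E] [Field K] [Algebra (ZMod 3) K] [Algebra E K]
    (hE : Nat.card E = 3 ^ 2) (hK : Nat.card K = 3 ^ (ρ - 1))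
    (β : K) (hβ : IsPrimitiveRoot β (4 * ρ)) :
    NegacyclicCodes.IsNegacyclic (NegacyclicCodes.codeRho ρ β) ∧
    NegacyclicCodes.IsCheckPolynomial (-1) (NegacyclicCodes.codeRho ρ β)
      (minpoly (ZMod 3) β) ∧
    Irreducible (minpoly (ZMod 3) β) ∧
    NegacyclicCodes.IsNegacyclic (NegacyclicCodes.codeRhoBar E ρ β) ∧
    Module.finrank (ZMod 3) (NegacyclicCodes.codeRho ρ β) = ρ - 1 ∧
    NegacyclicCodes.minDist (NegacyclicCodes.codeRhoBar E ρ β) ≤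
      NegacyclicCodes.minDist (NegacyclicCodes.codeRho ρ β) ∧
    Real.sqrt ρ + 1 ≤ (NegacyclicCodes.minDist (NegacyclicCodes.codeRhoBar E ρ β) : ℝ) := by
  open NegacyclicCodes in
  have : Fact (Nat.Prime 3) := ⟨Nat.prime_three⟩
  have : Finite K := Nat.finite_of_card_ne_zero (by rw [hK]; positivity)
  have : Finite E := Nat.finite_of_card_ne_zero (by rw [hE]; norm_num)
  have hodd : Odd ρ := hρ.odd_of_ne_two (by omega)
  have hρ0 : ρ ≠ 0 := hρ.ne_zero
  have hKchar : CharP K 3 := charP_of_injective_algebraMap (algebraMap (ZMod 3) K).injective 3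
  have hEchar : CharP E 3 := (algebraMap E K).charP (algebraMap E K).injective 3
  let _ : Algebra (ZMod 3) E := ZMod.algebra E 3
  have : IsScalarTower (ZMod 3) E K := IsScalarTower.of_algebraMap_eq' (Subsingleton.elim _ _)
  have hfin : Module.finrank (ZMod 3) K = ρ - 1 := finrank_of_natCard_eq hK
  have htop := adjoin_eq_top_of_orderOf (p := 3) (by exact_mod_cast hord) hfin (hβ.ne_zero (by omega)) hβ
  have hβn := pow_two_mul_eq_neg_one hρ0 hβ
  have hθ : IsPrimitiveRoot β⁻¹ (4 * ρ) := hβ.inv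
  have hθn := pow_two_mul_eq_neg_one hρ0 hθ
  obtain ⟨hrange, hdim⟩ := finrank_negacyclicCode_and_eq_range (by omega) hβn htop
  rw [hfin] at hdim
  -- `-1` is a square in `GF(9)`, and its two roots map to `±θ^ρ`; the sign is chosen to match.
  obtain ⟨ι, hι, hιθ⟩ : ∃ ι : E, ι ^ 2 = -1 ∧ algebraMap E K ι = β⁻¹ ^ ρ := by
    have : Fintype E := Fintype.ofFinite E
    obtain ⟨i, hi⟩ := (FiniteField.isSquare_neg_one_iff (F := E)).mpr (by
      rw [← Nat.card_eq_fintype_card, hE]; norm_num)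
    have h1 : (β⁻¹ ^ ρ) ^ 2 = (algebraMap E K i) ^ 2 := by
      rw [← pow_mul, mul_comm ρ, hθn, sq, ← map_mul, ← hi, map_neg, map_one]
    rcases sq_eq_sq_iff_eq_or_eq_neg.mp h1 with h | h
    · exact ⟨i, by rw [sq, hi], h.symm⟩
    · exact ⟨-i, by rw [neg_sq, sq, hi], by rw [map_neg, h]⟩
  have hint : IsIntegral (ZMod 3) β := Algebra.IsIntegral.isIntegral β
  have hbar := codeRhoBar_eq_range E ρ β
  have hne : codeRho ρ β ≠ ⊥ := by
    intro h
    rw [codeRho] at h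
    rw [h, finrank_bot] at hdim
    omega
  have hmem : ∀ c ∈ codeRho ρ β, c ≠ 0 → ∃ z ∈ codeRhoBar E ρ β, z ≠ 0 ∧
      hammingNorm z ≤ hammingNorm c := by
    intro c hc hc0
    rw [codeRho, hrange] at hc
    obtain ⟨a, rfl⟩ := hc
    rw [hbar]
    exact ⟨_, ⟨a, rfl⟩, fun h => hc0 (traceWord_eq_zero_of_sq hodd hθn hιθ h),
      hammingNorm_traceWord_le hE hodd hθn hι hιθ⟩
  obtain ⟨c, hc, hc0, hcd⟩ := exists_hammingNorm_eq_minDist hne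
  obtain ⟨z, hz, hz0, hzc⟩ := hmem c hc hc0
  refine ⟨isConstacyclic_comap_idealOf _ _,
    isCheckPolynomial_negacyclicCode (by omega) (minpoly.monic hint)
      (minpoly_dvd_of_pow_eq hβn), minpoly.irreducible hint, ?_, hdim, ?_, ?_⟩
  · rw [hbar]
    exact isNegacyclic_range_traceWord (by rw [← pow_mul, hθn])
  · rw [← hcd]
    exact (minDist_le_hammingNorm hz hz0).trans hzc
  · obtain ⟨w, hw, hw0, hwd⟩ :=
      exists_hammingNorm_eq_minDist (Submodule.ne_bot_iff _ |>.mpr ⟨z, hz, hz0⟩)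
    rw [← hwd]
    rw [hbar] at hw
    obtain ⟨a, rfl⟩ := hw
    have h2 : (2 : K) ≠ 0 := by
      have := (CharP.cast_eq_zero_iff K 3 2).not.mpr (by norm_num)
      exact_mod_cast this
    have hρK : (ρ : K) ≠ 0 := by
      rw [Ne, CharP.cast_eq_zero_iff K 3, Nat.prime_dvd_prime_iff_eq Nat.prime_three hρ]
      omega
    have h3ρ : ((3 : ℕ) : ZMod ρ) ≠ 0 := by
      rw [Ne, ZMod.natCast_eq_zero_iff, Nat.prime_dvd_prime_iff_eq hρ Nat.prime_three]
      omega
    have hb := le_hammingNorm_traceWord_sub_one_sq hρ (by omega) h2 (s := 3) (by decide) hE h3ρ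
      hρK hθ hw0
    have hpos : 1 ≤ hammingNorm (traceWord E ρ (β⁻¹ ^ 2) a) := hammingNorm_pos_iff.mpr hw0
    rw [← le_sub_iff_add_le, ← Nat.cast_one, ← Nat.cast_sub hpos]
    exact Real.sqrt_le_iff.mpr ⟨by positivity, by exact_mod_cast hb⟩
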